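/- Let $\mathcal{O}_1,\dots,\mathcal{O}_{N}\subset\mathbb{R}^2$ be convex polygonal obstacles (each the convex hull of a finite non-empty set of vertices), let $\rho>0$, and let $\bar{\mathcal{O}}_k=\mathcal{O}_k\oplus B(\rho)$ be the inflated obstacles (Minkowski sum with the closed disc of radius $\rho$ centred at the origin). Assume that the $\bar{\mathcal{O}}_k$ have pairwise disjoint interiors, and let $F=\mathbb{R}^2\setminus\bigcup_k \operatorname{int}\bar{\mathcal{O}}_k$. For two points $a,b$, the $\mathcal{C}^1$-tangent graph with terminals $a,b$ is the following (geometric) graph. Its generating bodies are the sets $\bar{\mathcal{O}}_k$ and the two one-point bodies $\{a\}$, $\{b\}$. A line is tangent to a body if it meets the body but not its interior. The nodes are the points at which a common tangent line of two different bodies touches these bodies; in particular $a$ and $b$ are nodes. The edges are the segments in $F$ that join touching points, on two different bodies, of a common tangent line, and the arcs of the boundaries $\partial\bar{\mathcal{O}}_k$ in $F$ between nodes. A path of the graph from $a$ to $b$ is a concatenation of finitely many edges leading from $a$ to $b$, parametrized by travelled distance. It is a shortest path if its length is minimal among all paths of this graph from $a$ to $b$. Let $\mathbf{P}_1$ be a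 shortest path from $\mathbf{r}_{11}$ to $\mathbf{r}_{12}$ in the $\mathcal{C}^1$-tangent graph with terminals $\mathbf{r}_{11},\mathbf{r}_{12}$, and let $\mathbf{P}_2$ be a shortest path from $\mathbf{r}_{21}$ to $\mathbf{r}_{22}$ in the $\mathcal{C}^1$-tangent graph with terminals $\mathbf{r}_{21},\mathbf{r}_{22}$. Suppose that at least one of $\mathbf{P}_1,\mathbf{P}_2$ is the only shortest path between its terminals. Then $\mathbf{P}_1$ and $\mathbf{P}_2$ intersect at most once, i.e. the set of their common points is connected (it is empty, a single point, or one single common segment of the two paths). -/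

import Mathlib

open Set
open scoped Pointwise

/-- The Euclidean plane. -/
abbrev Plane : Type := EuclideanSpace ℝ (Fin 2)

/-- An obstacle environment in the plane: finitely many convex polygonal obstacles, each one given
by its vertices, and the inflation radius. The inflated obstacles have pairwise non-overlapping
interiors. -/
structure Environment where
  /-- number of obstacles -/
  N : ℕ
  /-- vertices of each obstacle -/
  vertices : Fin N → Finset Plane
  vertices_nonempty : ∀ k, (vertices k).Nonempty
  /-- inflation radius -/
  ρ : ℝ
  ρ_pos : 0 < ρ
  nonoverlapping : ∀ k l, k ≠ l →
    Disjoint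
      (interior (convexHull ℝ (vertices k : Set Plane) + Metric.closedBall (0 : Plane) ρ))
      (interior (convexHull ℝ (vertices l : Set Plane) + Metric.closedBall (0 : Plane) ρ))

namespace Environment

/-- The `k`-th obstacle: the convex hull of its vertices. -/
def obstacle (W : Environment) (k : Fin W.N) : Set Plane :=
  convexHull ℝ (W.vertices k : Set Plane)

/-- The `k`-th inflated obstacle: Minkowski sum of the obstacle and a disc of radius `ρ`. -/
def inflated (W : Environment) (k : Fin W.N) : Set Plane :=
  W.obstacle k + Metric.closedBall (0 : Plane) W.ρ

/-- The region where paths may run: the plane without the interiors of the inflated obstacles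
(running along the boundary of an inflated obstacle is allowed). -/
def free (W : Environment) : Set Plane :=
  {p | ∀ k, p ∉ interior (W.inflated k)}

/-- The convex bodies whose common tangents generate the graph for a path from `a` to `b`: the
inflated obstacles, and the two terminal points as degenerate bodies. -/
def body (W : Environment) (a b : Plane) : Fin W.N ⊕ Bool → Set Plane
  | Sum.inl k => W.inflated k
  | Sum.inr false => {a}
  | Sum.inr true => {b}

/-- The line through `p` with direction `v ≠ 0` is tangent to the convex set `K` at `p`: it touches
`K` at `p` and does not meet the interior of `K`. (Every line through `p` is tangent to `{p}`.) -/
def TangentAt (K : Set Plane) (p v : Plane) : Prop :=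
  v ≠ 0 ∧ p ∈ K ∧ ∀ t : ℝ, p + t • v ∉ interior K

/-- `p` and `q` lie on a common tangent line of the two different bodies `i` and `j`, which touches
the former at `p` and the latter at `q`. -/
def IsCommonTangent (W : Environment) (a b : Plane) (i j : Fin W.N ⊕ Bool) (p q : Plane) : Prop :=
  i ≠ j ∧ ∃ v : Plane, TangentAt (W.body a b i) p v ∧ TangentAt (W.body a b j) q v ∧
    ∃ t : ℝ, q = p + t • v

/-- The nodes of the `C¹`-tangent graph with terminals `a` and `b`: the points where common tangents
touch the bodies (`a` and `b` are nodes, because of the line through `a` and `b`). -/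
def IsNode (W : Environment) (a b p : Plane) : Prop :=
  ∃ i j q, W.IsCommonTangent a b i j p q

/-- On the parameter interval `[s, t]` the curve `γ` traverses a common tangent segment. -/
def IsTangentEdge (W : Environment) (a b : Plane) (γ : ℝ → Plane) (s t : ℝ) : Prop :=
  (∃ i j, W.IsCommonTangent a b i j (γ s) (γ t)) ∧
    ∃ w : Plane, ∀ u ∈ Icc s t, γ u = γ s + (u - s) • w

/-- On the parameter interval `[s, t]` the curve `γ` traverses, from one node to another, an arc of
the boundary of one inflated obstacle. -/
def IsArcEdge (W : Environment) (a b : Plane) (γ : ℝ → Plane) (s t : ℝ) : Prop :=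
  W.IsNode a b (γ s) ∧ W.IsNode a b (γ t) ∧ InjOn γ (Icc s t) ∧
    ∃ k, ∀ u ∈ Icc s t, γ u ∈ frontier (W.inflated k)

/-- A path from `a` to `b` in the `C¹`-tangent graph (with the terminals `a`, `b` added to the
graph): a curve in the free region, parametrized on `[0, len]` by the travelled distance, that is a
concatenation of finitely many edges of the graph. Values of `curve` outside `[0, len]` are
irrelevant. -/
structure TangentGraphPath (W : Environment) (a b : Plane) where
  /-- total length -/
  len : ℝ
  len_nonneg : 0 ≤ len
  /-- position after travelling a given distance -/
  curve : ℝ → Plane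
  unit_speed : HasUnitSpeedOn curve (Icc 0 len)
  curve_zero : curve 0 = a
  curve_len : curve len = b
  mem_free : ∀ u ∈ Icc 0 len, curve u ∈ W.free
  edges : ∃ (n : ℕ) (t : ℕ → ℝ), Monotone t ∧ t 0 = 0 ∧ t n = len ∧
    ∀ m < n, W.IsTangentEdge a b curve (t m) (t (m + 1)) ∨
      W.IsArcEdge a b curve (t m) (t (m + 1))

namespace TangentGraphPath

variable {W : Environment} {a b : Plane}

/-- The set of points of the path. -/
def trace (P : W.TangentGraphPath a b) : Set Plane :=
  P.curve '' Icc 0 P.len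

/-- `P` is a shortest path from `a` to `b` in the `C¹`-tangent graph. -/
def IsShortest (P : W.TangentGraphPath a b) : Prop :=
  ∀ Q : W.TangentGraphPath a b, P.len ≤ Q.len

/-- `P` is the only shortest path from `a` to `b` in the `C¹`-tangent graph. -/
def IsUniqueShortest (P : W.TangentGraphPath a b) : Prop :=
  P.IsShortest ∧ ∀ Q : W.TangentGraphPath a b, Q.IsShortest → EqOn Q.curve P.curve (Icc 0 P.len)

end TangentGraphPath

end Environment

/-! The graph is eliminated from the problem: its shortest paths are exactly the shortest curves
(geodesics) in the free region $F$ (`isShortest_iff`). Uniqueness then gives the theorem by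
exchange. If the unique path $P_1$ meets $P_2$ in two points, the sections of both paths between
them are shortest, so they have equal length. Replacing the section of $P_1$ by that of $P_2$
(`IsGeodesic.splice`) gives another geodesic, hence a shortest graph path, which uniqueness forces
to equal $P_1$. So $P_2$ contains the section of $P_1$.

Every geodesic of $F$ must therefore be a finite concatenation of graph edges. It meets each convex
inflated obstacle in an interval of time, since projecting an excursion onto the obstacle would
shorten it (`IsGeodesic.mem_of_convex`). The finitely many ends of these intervals cut it into
boundary arcs and pieces off the obstacles. The latter are straight
(`IsGeodesic.exists_affine_of_mem_interior`) and meet the obstacles tangentially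
(`inner_eq_zero_of_isGeodesic`); here the radius `ρ` enters, as each boundary point lies on a disc
of that radius inside the obstacle.

Conversely, a shortest graph path is a geodesic because a geodesic between its terminals exists by
compactness (`JoinedWithin.exists_isGeodesic`) and is itself a graph path. Curves of speed at most
one are used throughout because this condition survives limits, gluing and projection; a geodesic
then has unit speed automatically. -/

open scoped RealInnerProductSpace Topology

/-! ### Curves of speed at most one and geodesics in a metric space -/

section Metric

variable {X : Type*} [MetricSpace X]

/-- On `[s, t]` the curve `γ` moves with speed at most one. -/
def NonexpansiveOn (γ : ℝ → X) (s t : ℝ) : Prop :=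
  ∀ x y, s ≤ x → x ≤ y → y ≤ t → dist (γ x) (γ y) ≤ y - x

namespace NonexpansiveOn

variable {γ δ : ℝ → X} {a b c s t : ℝ}

theorem dist_le (h : NonexpansiveOn γ s t) {x y : ℝ} (hx : x ∈ Icc s t) (hy : y ∈ Icc s t) :
    dist (γ x) (γ y) ≤ |x - y| := by
  rcases le_total x y with hxy | hxy
  · rw [abs_sub_comm, abs_of_nonneg (sub_nonneg.2 hxy)]
    exact h x y hx.1 hxy hy.2
  · rw [dist_comm, abs_of_nonneg (sub_nonneg.2 hxy)]
    exact h y x hy.1 hxy hx.2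

theorem lipschitzOnWith (h : NonexpansiveOn γ s t) : LipschitzOnWith 1 γ (Icc s t) :=
  LipschitzOnWith.of_dist_le_mul fun x hx y hy => by
    simpa [Real.dist_eq] using h.dist_le hx hy

theorem continuousOn (h : NonexpansiveOn γ s t) : ContinuousOn γ (Icc s t) :=
  h.lipschitzOnWith.continuousOn

theorem mono (h : NonexpansiveOn γ s t) (ha : s ≤ a) (hb : b ≤ t) : NonexpansiveOn γ a b :=
  fun x y hx hxy hy => h x y (ha.trans hx) hxy (hy.trans hb)

theorem congr (h : NonexpansiveOn γ s t) (hγ : EqOn δ γ (Icc s t)) : NonexpansiveOn δ s t :=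
  fun x y hx hxy hy => by
    rw [hγ ⟨hx, hxy.trans hy⟩, hγ ⟨hx.trans hxy, hy⟩]
    exact h x y hx hxy hy

theorem glue (h : NonexpansiveOn γ a b) (h' : NonexpansiveOn γ b c) : NonexpansiveOn γ a c := by
  intro x y hx hxy hy
  rcases le_total y b with hyb | hyb
  · exact h x y hx hxy hyb
  rcases le_total b x with hbx | hbx
  · exact h' x y hbx hxy hy
  have := dist_triangle (γ x) (γ b) (γ y)
  have := h x b hx hbx le_rfl
  have := h' b y le_rfl hyb hy
  linarith

theorem comp_add (h : NonexpansiveOn γ s t) (c : ℝ) :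
    NonexpansiveOn (fun u => γ (u + c)) (s - c) (t - c) := fun x y hx hxy hy =>
  (h (x + c) (y + c) (by linarith) (by linarith) (by linarith)).trans (by linarith)

theorem comp_sub_left (h : NonexpansiveOn γ s t) (c : ℝ) :
    NonexpansiveOn (fun u => γ (c - u)) (c - t) (c - s) := fun x y hx hxy hy => by
  rw [dist_comm]
  exact (h (c - y) (c - x) (by linarith) (by linarith) (by linarith)).trans (by linarith)

end NonexpansiveOn

/-- The points `x` and `y` are joined inside `F` by a curve whose length is at most `M`. -/
def JoinedWithin (F : Set X) (x y : X) (M : ℝ) : Prop :=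
  0 ≤ M ∧ ∃ γ : ℝ → X, γ 0 = x ∧ γ M = y ∧ NonexpansiveOn γ 0 M ∧ ∀ u ∈ Icc 0 M, γ u ∈ F

/-- A curve along which the distances are bounded by the increments of a continuous function `τ`
can be reparametrized by `τ`. -/
theorem joinedWithin_of_reparam {F : Set X} {f : ℝ → X} {τ : ℝ → ℝ} {s t : ℝ} (hst : s ≤ t)
    (hτ : ContinuousOn τ (Icc s t))
    (hf : ∀ x y, s ≤ x → x ≤ y → y ≤ t → dist (f x) (f y) ≤ τ y - τ x)
    (hF : ∀ x ∈ Icc s t, f x ∈ F) : JoinedWithin F (f s) (f t) (τ t - τ s) := by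
  have h0 : 0 ≤ τ t - τ s := dist_nonneg.trans (hf s t le_rfl hst le_rfl)
  -- By `hf`, `τ` is nondecreasing and `f` is constant wherever `τ` is, so the choice of preimages
  -- is immaterial. The value 0 outside the range is a dummy.
  have key : ∀ v, ∃ x, v ∈ Icc 0 (τ t - τ s) → x ∈ Icc s t ∧ τ x = τ s + v := by
    intro v
    by_cases hv : v ∈ Icc 0 (τ t - τ s)
    · obtain ⟨x, hx, hxv⟩ := intermediate_value_Icc hst hτ
        (show τ s + v ∈ Icc (τ s) (τ t) from ⟨by linarith [hv.1], by linarith [hv.2]⟩)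
      exact ⟨x, fun _ => ⟨hx, hxv⟩⟩
    · exact ⟨0, fun h => absurd h hv⟩
  choose φ hφ using key
  refine ⟨h0, f ∘ φ, ?_, ?_, ?_, fun u hu => hF _ (hφ u hu).1⟩
  · obtain ⟨hx, hv⟩ := hφ 0 ⟨le_rfl, h0⟩
    have := hf s (φ 0) le_rfl hx.1 hx.2
    exact (dist_le_zero.1 (by linarith : dist (f s) (f (φ 0)) ≤ 0)).symm
  · obtain ⟨hx, hv⟩ := hφ (τ t - τ s) ⟨h0, le_rfl⟩
    have := hf (φ (τ t - τ s)) t hx.1 hx.2 le_rfl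
    exact dist_le_zero.1 (by linarith : dist (f (φ (τ t - τ s))) (f t) ≤ 0)
  · intro v w hv hvw hw
    obtain ⟨hx, hxv⟩ := hφ v ⟨hv, hvw.trans hw⟩
    obtain ⟨hy, hyw⟩ := hφ w ⟨hv.trans hvw, hw⟩
    rcases le_total (φ v) (φ w) with h | h
    · have := hf _ _ hx.1 h hy.2
      simp only [Function.comp]
      linarith
    · have := hf _ _ hy.1 h hx.2
      rw [dist_comm] at this
      simp only [Function.comp]
      linarith

namespace JoinedWithin

variable {F : Set X} {x y z : X} {M M' : ℝ}

theorem of_nonexpansiveOn {f : ℝ → X} {s t : ℝ} (hst : s ≤ t) (hf : NonexpansiveOn f s t)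
    (hF : ∀ x ∈ Icc s t, f x ∈ F) : JoinedWithin F (f s) (f t) (t - s) :=
  joinedWithin_of_reparam (τ := id) hst continuousOn_id hf hF

theorem symm (h : JoinedWithin F x y M) : JoinedWithin F y x M := by
  obtain ⟨h0, γ, rfl, rfl, hγ, hF⟩ := h
  have := of_nonexpansiveOn (F := F) (f := fun u => γ (M - u)) (s := 0) (t := M) h0
    (by simpa using hγ.comp_sub_left M)
    (fun u hu => hF _ ⟨by linarith [hu.2], by linarith [hu.1]⟩)
  simpa using this

theorem trans (h : JoinedWithin F x y M) (h' : JoinedWithin F y z M') :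
    JoinedWithin F x z (M + M') := by
  obtain ⟨h0, γ, rfl, rfl, hγ, hF⟩ := h
  obtain ⟨h0', δ, hδ0, rfl, hδ, hF'⟩ := h'
  refine ⟨by linarith, fun u => if u ≤ M then γ u else δ (u - M), by simp [h0], ?_, ?_, ?_⟩
  · rcases h0'.eq_or_lt with h | h
    · subst h; simp [hδ0]
    · simp [h]
  · refine NonexpansiveOn.glue (b := M) (hγ.congr fun u hu => by simp [hu.2]) ?_
    have h2 := hδ.comp_add (-M)
    simp only [sub_neg_eq_add, zero_add] at h2
    rw [add_comm]
    refine h2.congr fun u hu => ?_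
    rcases hu.1.eq_or_lt with h | h
    · subst h; simp [hδ0]
    · simp [h, sub_eq_add_neg]
  · intro u hu
    by_cases h : u ≤ M
    · simpa [h] using hF u ⟨hu.1, h⟩
    · simp only [h, if_false]
      exact hF' _ ⟨by linarith, by linarith [hu.2]⟩

end JoinedWithin

/-- `γ` is, on `[0, L]`, a shortest curve inside `F` between its endpoints, travelled with speed at
most one. -/
structure IsGeodesic (F : Set X) (γ : ℝ → X) (L : ℝ) : Prop where
  nonneg : 0 ≤ L
  nonexpansive : NonexpansiveOn γ 0 L
  mem : ∀ u ∈ Icc 0 L, γ u ∈ F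
  le_of_joinedWithin : ∀ M, JoinedWithin F (γ 0) (γ L) M → L ≤ M

namespace IsGeodesic

variable {F : Set X} {γ : ℝ → X} {L s t M : ℝ}

theorem joinedWithin (h : IsGeodesic F γ L) (hs : 0 ≤ s) (hst : s ≤ t) (ht : t ≤ L) :
    JoinedWithin F (γ s) (γ t) (t - s) :=
  .of_nonexpansiveOn hst (h.nonexpansive.mono hs ht)
    fun u hu => h.mem u ⟨hs.trans hu.1, hu.2.trans ht⟩

/-- A shorter connection of two points of the geodesic, inserted between the remaining sections,
would shorten the whole. -/
theorem sub_le (h : IsGeodesic F γ L) (hs : 0 ≤ s) (hst : s ≤ t) (ht : t ≤ L)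
    (hM : JoinedWithin F (γ s) (γ t) M) : t - s ≤ M := by
  have := h.le_of_joinedWithin _ (((h.joinedWithin le_rfl hs (hst.trans ht)).trans hM).trans
    (h.joinedWithin (hs.trans hst) ht le_rfl))
  linarith

theorem reverse (h : IsGeodesic F γ L) : IsGeodesic F (fun u => γ (L - u)) L where
  nonneg := h.nonneg
  nonexpansive := by simpa using h.nonexpansive.comp_sub_left L
  mem u hu := h.mem _ ⟨by linarith [hu.2], by linarith [hu.1]⟩
  le_of_joinedWithin M hM := h.le_of_joinedWithin M (by simpa using hM.symm)

theorem injOn (h : IsGeodesic F γ L) : InjOn γ (Icc 0 L) := by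
  have key : ∀ x ∈ Icc 0 L, ∀ y ∈ Icc 0 L, x ≤ y → γ x = γ y → x = y := by
    intro x hx y hy hxy he
    have hj : JoinedWithin F (γ x) (γ y) 0 :=
      ⟨le_rfl, fun _ => γ x, rfl, he, fun u v _ huv _ => by simpa using huv, fun _ _ => h.mem x hx⟩
    have := h.sub_le hx.1 hxy hy.2 hj
    linarith
  intro x hx y hy he
  rcases le_total x y with hxy | hxy
  · exact key x hx y hy hxy he
  · exact (key y hy x hx hxy he.symm).symm

/-- The replacement uses the same parameter interval, so the total time remains `L`; minimality
depends only on `L` and the two endpoints, which do not change. -/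
theorem splice (h : IsGeodesic F γ L) {δ : ℝ → X} (hs : 0 ≤ s) (hst : s ≤ t) (ht : t ≤ L)
    (hδ : NonexpansiveOn δ s t) (hδs : δ s = γ s) (hδt : δ t = γ t) (hF : ∀ u ∈ Icc s t, δ u ∈ F) :
    ∃ γ', IsGeodesic F γ' L ∧ γ' 0 = γ 0 ∧ γ' L = γ L ∧ EqOn γ' δ (Icc s t) := by
  classical
  have hl : EqOn (fun u => if u ∈ Icc s t then δ u else γ u) γ (Icc 0 s) := by
    intro u hu
    rcases hu.2.eq_or_lt with he | hlt
    · subst he; simp [hst, hδs]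
    · simp [hlt]
  have hr : EqOn (fun u => if u ∈ Icc s t then δ u else γ u) γ (Icc t L) := by
    intro u hu
    rcases hu.1.eq_or_lt with he | hlt
    · subst he; simp [hst, hδt]
    · simp [hlt]
  refine ⟨_, ⟨h.nonneg, ?_, ?_, ?_⟩, hl ⟨le_rfl, hs⟩, hr ⟨ht, le_rfl⟩, fun u hu => if_pos hu⟩
  · refine .glue (b := s) ((h.nonexpansive.mono le_rfl (hst.trans ht)).congr hl)
      (.glue (b := t) (hδ.congr fun u hu => if_pos hu)
        ((h.nonexpansive.mono (hs.trans hst) le_rfl).congr hr))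
  · intro u hu
    by_cases hu' : u ∈ Icc s t
    · simpa only [if_pos hu'] using hF u hu'
    · simpa only [if_neg hu'] using h.mem u hu
  · intro M hM
    have h0 := hl ⟨le_rfl, hs⟩
    have hL := hr ⟨ht, le_rfl⟩
    simp only at h0 hL
    rw [h0, hL] at hM
    exact h.le_of_joinedWithin M hM

/-- The variation `τ` grows at most as fast as the parameter. Reparametrizing by `τ` gives a
competitor of length `τ L - τ 0`, so minimality leaves no room for a loss on any subinterval. -/
theorem hasUnitSpeedOn (h : IsGeodesic F γ L) : HasUnitSpeedOn γ (Icc 0 L) := by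
  have hlip := h.nonexpansive.lipschitzOnWith
  have hbv := hlip.locallyBoundedVariationOn
  have h0 : (0 : ℝ) ∈ Icc 0 L := ⟨le_rfl, h.nonneg⟩
  have hL : L ∈ Icc 0 L := ⟨h.nonneg, le_rfl⟩
  set τ := variationOnFromTo γ (Icc 0 L) 0 with hτ
  have hadd : ∀ x ∈ Icc 0 L, ∀ y ∈ Icc 0 L, τ y - τ x = variationOnFromTo γ (Icc 0 L) x y := by
    intro x hx y hy
    have := variationOnFromTo.add hbv h0 hx hy
    linarith
  have hle : ∀ x ∈ Icc 0 L, ∀ y ∈ Icc 0 L, x ≤ y → τ y - τ x ≤ y - x := by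
    intro x hx y hy hxy
    rw [hadd x hx y hy, variationOnFromTo.eq_of_le _ _ hxy]
    have h1 : eVariationOn γ (Icc 0 L ∩ Icc x y) ≤ ENNReal.ofReal (y - x) := by
      have h2 := (hlip.mono (inter_subset_left (t := Icc x y))).comp_eVariationOn_le
        (g := (id : ℝ → ℝ)) (s := Icc 0 L ∩ Icc x y) (fun u hu => hu)
      have h3 := (monotone_id.monotoneOn (Icc 0 L)).eVariationOn_eq hx hy
      rw [h3] at h2
      simpa using h2
    exact ENNReal.toReal_le_of_le_ofReal (sub_nonneg.2 hxy) h1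
  have hge : ∀ x y, 0 ≤ x → x ≤ y → y ≤ L → dist (γ x) (γ y) ≤ τ y - τ x := by
    intro x y hx hxy hy
    have hx' : x ∈ Icc 0 L := ⟨hx, hxy.trans hy⟩
    have hy' : y ∈ Icc 0 L := ⟨hx.trans hxy, hy⟩
    rw [hadd x hx' y hy', variationOnFromTo.eq_of_le _ _ hxy]
    exact (hbv x y hx' hy').dist_le ⟨hx', le_rfl, hxy⟩ ⟨hy', hxy, le_rfl⟩
  have hτn : NonexpansiveOn τ 0 L := fun x y hx hxy hy => by
    have h1 := hge x y hx hxy hy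
    rw [dist_comm, Real.dist_eq, abs_of_nonneg (dist_nonneg.trans h1)]
    exact hle x ⟨hx, hxy.trans hy⟩ y ⟨hx.trans hxy, hy⟩ hxy
  have htot := h.le_of_joinedWithin _ (joinedWithin_of_reparam h.nonneg hτn.continuousOn hge h.mem)
  refine hasConstantSpeedOnWith_iff_variationOnFromTo_eq.2 ⟨hbv, ?_⟩
  have key : ∀ x ∈ Icc 0 L, τ x - τ 0 = x := by
    intro x hx
    have h1 := hle 0 h0 x hx hx.1
    have h2 := hle x hx L hL hx.2
    linarith
  intro x hx y hy
  rw [← hadd x hx y hy]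
  have := key x hx
  have := key y hy
  simp only [NNReal.coe_one]
  linarith

end IsGeodesic

/-- Two points of a closed set that are joined inside it by a curve of finite length are joined by a
shortest one. -/
theorem JoinedWithin.exists_isGeodesic [ProperSpace X] {F : Set X} (hF : IsClosed F) {x y : X}
    {M : ℝ} (h : JoinedWithin F x y M) :
    ∃ L γ, L ≤ M ∧ IsGeodesic F γ L ∧ γ 0 = x ∧ γ L = y := by
  set S := {M | JoinedWithin F x y M} with hS
  have hbdd : BddBelow S := ⟨0, fun M hM => hM.1⟩
  have hL0 : 0 ≤ sInf S := le_csInf ⟨M, h⟩ fun M hM => hM.1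
  let K : Ioi (sInf S) → Set (ℝ → X) := fun m =>
    {g | (∀ s t, dist (g s) (g t) ≤ |s - t|) ∧ (∀ u, g u ∈ F) ∧ g 0 = x ∧ ∀ u, m.1 ≤ u → g u = y}
  have hclosed : ∀ m, IsClosed (K m) := by
    intro m
    refine IsClosed.inter ?_ (IsClosed.inter ?_ (IsClosed.inter ?_ ?_))
    · change IsClosed {g : ℝ → X | ∀ s t, dist (g s) (g t) ≤ |s - t|}
      simp only [ofPred_forall]
      exact isClosed_iInter fun s => isClosed_iInter fun t =>
        isClosed_le (by fun_prop) continuous_const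
    · change IsClosed {g : ℝ → X | ∀ u, g u ∈ F}
      simp only [ofPred_forall]
      exact isClosed_iInter fun s => hF.preimage (continuous_apply s)
    · exact isClosed_eq (by fun_prop) continuous_const
    · change IsClosed {g : ℝ → X | ∀ u, m.1 ≤ u → g u = y}
      simp only [ofPred_forall]
      exact isClosed_iInter fun s => isClosed_iInter fun _ =>
        isClosed_eq (by fun_prop) continuous_const
  have hcompact : ∀ m, IsCompact (K m) := by
    intro m
    refine (isCompact_univ_pi fun u : ℝ => isCompact_closedBall x |u|).of_isClosed_subset
      (hclosed m) fun g hg u _ => ?_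
    have := hg.1 u 0
    rw [hg.2.2.1] at this
    simpa using this
  have hne : ∀ m, (K m).Nonempty := by
    rintro ⟨m, hm⟩
    obtain ⟨m', ⟨h0, γ, hγ0, hγm, hγ, hγF⟩, hlt⟩ := exists_lt_of_csInf_lt ⟨M, h⟩ hm
    refine ⟨fun u => γ (projIcc 0 m' h0 u), fun s t => ?_, fun u => hγF _ (projIcc 0 m' h0 u).2, ?_, ?_⟩
    · refine (hγ.dist_le (projIcc 0 m' h0 s).2 (projIcc 0 m' h0 t).2).trans ?_
      exact abs_projIcc_sub_projIcc h0
    · simp [hγ0]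
    · intro u hu
      have : m' ≤ u := hlt.le.trans hu
      simp [projIcc_of_right_le _ this, hγm]
  have : Nonempty (Ioi (sInf S)) := ⟨⟨sInf S + 1, by simp⟩⟩
  obtain ⟨g, hg⟩ := IsCompact.nonempty_iInter_of_directed_nonempty_isCompact_isClosed K
    (fun m n => by
      refine ⟨m ⊓ n, fun g hg => ⟨hg.1, hg.2.1, hg.2.2.1, fun u hu => hg.2.2.2 u ?_⟩,
        fun g hg => ⟨hg.1, hg.2.1, hg.2.2.1, fun u hu => hg.2.2.2 u ?_⟩⟩
      · exact le_trans (show (m ⊓ n).1 ≤ m.1 from inf_le_left) hu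
      · exact le_trans (show (m ⊓ n).1 ≤ n.1 from inf_le_right) hu) hne hcompact hclosed
  rw [mem_iInter] at hg
  have hg0 := hg ⟨sInf S + 1, by simp⟩
  have hgL : g (sInf S) = y := by
    refine dist_le_zero.1 (le_of_forall_pos_le_add fun ε hε => ?_)
    have h1 := (hg ⟨sInf S + ε, by simpa using hε⟩).2.2.2 (sInf S + ε) le_rfl
    have h2 := hg0.1 (sInf S) (sInf S + ε)
    rw [h1] at h2
    simpa [abs_of_pos hε] using h2
  refine ⟨sInf S, g, csInf_le hbdd h, ⟨hL0, fun s t _ hst _ => ?_, fun u _ => hg0.2.1 u, ?_⟩,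
    hg0.2.2.1, hgL⟩
  · have := hg0.1 s t
    rwa [abs_sub_comm, abs_of_nonneg (sub_nonneg.2 hst)] at this
  · rw [hg0.2.2.1, hgL]
    exact fun m hm => csInf_le hbdd hm

theorem HasUnitSpeedOn.nonexpansiveOn {γ : ℝ → X} {s t : ℝ} (h : HasUnitSpeedOn γ (Icc s t)) :
    NonexpansiveOn γ s t := by
  intro x y hx hxy hy
  have h1 := h (x := x) ⟨hx, hxy.trans hy⟩ (y := y) ⟨hx.trans hxy, hy⟩
  have h2 : edist (γ x) (γ y) ≤ eVariationOn γ (Icc s t ∩ Icc x y) :=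
    eVariationOn.edist_le γ ⟨⟨hx, hxy.trans hy⟩, le_rfl, hxy⟩ ⟨⟨hx.trans hxy, hy⟩, hxy, le_rfl⟩
  rw [h1, edist_dist, ENNReal.ofReal_le_ofReal_iff (by simpa using hxy)] at h2
  simpa using h2

end Metric

/-! ### Projection onto convex sets, and straightness of geodesics -/

section InnerProduct

variable {E : Type*} [NormedAddCommGroup E] [InnerProductSpace ℝ E]

theorem exists_convex_projection {K : Set E} (hne : K.Nonempty) (hc : IsComplete K)
    (hK : Convex ℝ K) : ∃ π : E → E, ∀ x, π x ∈ K ∧ ∀ w ∈ K, ⟪x - π x, w - π x⟫ ≤ 0 := by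
  have key : ∀ x, ∃ y, y ∈ K ∧ ∀ w ∈ K, ⟪x - y, w - y⟫ ≤ 0 := by
    intro x
    obtain ⟨v, hv, hvx⟩ := exists_norm_eq_iInf_of_complete_convex hne hc hK x
    exact ⟨v, hv, (norm_eq_iInf_iff_real_inner_le_zero hK hv).1 hvx⟩
  exact ⟨fun x => (key x).choose, fun x => (key x).choose_spec⟩

/-- The projection onto a convex set is nonexpansive, with a gain coming from the variation of the
distance to the set. -/
theorem norm_sq_projection_sub_add_le {x y p q : E} (hx : ⟪x - p, q - p⟫ ≤ 0)
    (hy : ⟪y - q, p - q⟫ ≤ 0) :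
    ‖p - q‖ ^ 2 + (‖x - p‖ - ‖y - q‖) ^ 2 ≤ ‖x - y‖ ^ 2 := by
  have h1 : x - y = (p - q) + ((x - p) - (y - q)) := by abel
  have h2 : ‖x - y‖ ^ 2 = ‖p - q‖ ^ 2 + 2 * ⟪p - q, (x - p) - (y - q)⟫ + ‖(x - p) - (y - q)‖ ^ 2 := by
    rw [h1, norm_add_sq_real]
  have h3 : 0 ≤ ⟪p - q, (x - p) - (y - q)⟫ := by
    rw [inner_sub_right, real_inner_comm, real_inner_comm (y - q)]
    have : ⟪x - p, p - q⟫ = - ⟪x - p, q - p⟫ := by rw [← inner_neg_right, neg_sub]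
    linarith
  have h4 : (‖x - p‖ - ‖y - q‖) ^ 2 ≤ ‖(x - p) - (y - q)‖ ^ 2 := by
    rw [← sq_abs]
    gcongr
    exact abs_norm_sub_norm_le _ _
  linarith

theorem inner_lt_of_mem_interior {K : Set E} {n x : E} {c : ℝ} (hn : n ≠ 0)
    (hK : ∀ y ∈ K, ⟪n, y⟫ ≤ c) (hx : x ∈ interior K) : ⟪n, x⟫ < c := by
  obtain ⟨r, hr, hball⟩ := Metric.isOpen_iff.1 isOpen_interior x hx
  have hpos : 0 < ‖n‖ := norm_pos_iff.2 hn
  set ε := r / (2 * ‖n‖) with hε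
  have hε0 : 0 < ε := by positivity
  have hmem : x + ε • n ∈ K := by
    refine interior_subset (hball ?_)
    rw [Metric.mem_ball, dist_eq_norm, add_sub_cancel_left, norm_smul, Real.norm_eq_abs,
      abs_of_pos hε0, hε]
    field_simp
    linarith
  have := hK _ hmem
  rw [inner_add_right, inner_smul_right, real_inner_self_eq_norm_sq] at this
  have : 0 < ε * ‖n‖ ^ 2 := by positivity
  linarith

theorem joinedWithin_of_segment_subset {F : Set E} {x y : E} (h : segment ℝ x y ⊆ F) :
    JoinedWithin F x y (dist x y) := by
  have := joinedWithin_of_reparam (F := F) (f := AffineMap.lineMap x y) (τ := fun u => u * dist x y)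
    (s := 0) (t := 1) zero_le_one (by fun_prop)
    (fun u v hu huv hv => by
      rw [dist_lineMap_lineMap, Real.dist_eq, abs_sub_comm, abs_of_nonneg (sub_nonneg.2 huv)]
      linarith)
    (fun u hu => h (by rw [segment_eq_image_lineMap]; exact mem_image_of_mem _ hu))
  simpa using this

namespace IsGeodesic

variable {F : Set E} {γ : ℝ → E} {L : ℝ}

theorem sub_le_dist (h : IsGeodesic F γ L) {s t : ℝ} (hs : 0 ≤ s) (hst : s ≤ t) (ht : t ≤ L)
    (hF : segment ℝ (γ s) (γ t) ⊆ F) : t - s ≤ dist (γ s) (γ t) :=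
  h.sub_le hs hst ht (joinedWithin_of_segment_subset hF)

/-- A shortest curve outside the interior of a convex set `K` whose boundary may be used meets `K`
in an interval of parameters. -/
theorem mem_of_convex (h : IsGeodesic F γ L) {K : Set E} (hc : IsComplete K) (hK : Convex ℝ K)
    (hKF : ∀ x ∈ K, x ∉ interior K → x ∈ F) (hFK : ∀ x ∈ F, x ∉ interior K) {s u t : ℝ}
    (hs : 0 ≤ s) (hsu : s ≤ u) (hut : u ≤ t) (ht : t ≤ L) (hγs : γ s ∈ K) (hγt : γ t ∈ K) :
    γ u ∈ K := by
  by_contra hu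
  obtain ⟨π, hπ⟩ := exists_convex_projection ⟨_, hγs⟩ hc hK
  have hfix : ∀ x ∈ K, π x = x := by
    intro x hx
    have := (hπ x).2 x hx
    rw [real_inner_self_eq_norm_sq] at this
    have h0 : ‖x - π x‖ = 0 := by nlinarith [norm_nonneg (x - π x)]
    exact (sub_eq_zero.1 (norm_eq_zero.1 h0)).symm
  have hπF : ∀ x ∈ F, π x ∈ F := by
    intro x hx
    refine hKF _ (hπ x).1 fun hint => ?_
    by_cases hxK : x ∈ K
    · rw [hfix x hxK] at hint
      exact hFK x hx hint
    · have hne : x - π x ≠ 0 := fun h0 => hxK (by rw [sub_eq_zero.1 h0]; exact (hπ x).1)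
      have h1 := inner_lt_of_mem_interior (c := ⟪x - π x, π x⟫) hne
        (fun y hy => by have := (hπ x).2 y hy; rw [inner_sub_right] at this; linarith) hint
      exact lt_irrefl _ h1
  set d : ℝ → ℝ := fun v => ‖γ v - π (γ v)‖ with hd
  -- Infinitesimally: squared speed of the projected curve plus squared rate of change of the
  -- distance to `K` is at most one.
  have hkey : ∀ x y, s ≤ x → x ≤ y → y ≤ t →
      dist (π (γ x)) (π (γ y)) ^ 2 + (d x - d y) ^ 2 ≤ (y - x) ^ 2 := by
    intro x y hx hxy hy
    have h1 := norm_sq_projection_sub_add_le ((hπ (γ x)).2 _ (hπ (γ y)).1)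
      ((hπ (γ y)).2 _ (hπ (γ x)).1)
    have h2 := h.nonexpansive x y (hs.trans hx) hxy (hy.trans ht)
    rw [dist_eq_norm] at h2 ⊢
    exact h1.trans (by gcongr)
  have hdn : NonexpansiveOn d s t := fun x y hx hxy hy => by
    rw [Real.dist_eq]
    exact abs_le_of_sq_le_sq' (by nlinarith [hkey x y hx hxy hy, sq_nonneg (dist (π (γ x)) (π (γ y)))])
      (sub_nonneg.2 hxy) |> abs_le.2
  have hds : d s = 0 := by simp [hd, hfix _ hγs]
  have hm : 0 < d u := norm_pos_iff.2 fun h0 => hu (by rw [sub_eq_zero.1 h0]; exact (hπ _).1)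
  set m := d u with hmdef
  have hmℓ : m ≤ u - s := by
    have := hdn s u le_rfl hsu hut
    rw [dist_comm, Real.dist_eq, hds, sub_zero] at this
    exact (le_abs_self _).trans this
  set ℓ := u - s with hℓ
  have hℓ0 : 0 < ℓ := hm.trans_le hmℓ
  -- Half the mean slope of `d` on `[s, u]`, so that `κ ≤ 1/2` and `c > 0`. The tangent bound
  -- $\sqrt{1-x^2}\le(1-\kappa x)/\sqrt{1-\kappa^2}$, equivalent on $[-1,1]$ to $(x-\kappa)^2\ge 0$,
  -- avoids integration: the projection of this section has length at most $(\ell-\kappa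
  -- m)/c=\ell(1-2\kappa^2)/c<\ell$.
  set κ := m / (2 * ℓ) with hκ
  have hκ0 : 0 < κ := by positivity
  have hκ1 : κ ≤ 1 / 2 := by rw [hκ, div_le_iff₀ (by positivity)]; linarith
  have hmκ : m = 2 * κ * ℓ := by rw [hκ]; field_simp
  set c := √(1 - κ ^ 2) with hcdef
  have hc2 : c ^ 2 = 1 - κ ^ 2 := Real.sq_sqrt (by nlinarith)
  have hc0 : 0 < c := Real.sqrt_pos.2 (by nlinarith)
  have hJ := joinedWithin_of_reparam (F := F) (f := fun v => π (γ v)) (τ := fun v => (v - κ * d v) / c)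
    hsu
    (((continuousOn_id.sub (continuousOn_const.mul
      (hdn.continuousOn.mono (Icc_subset_Icc_right hut))))).div_const _)
    (fun x y hx hxy hy => by
      have h1 := hkey x y hx hxy (hy.trans hut)
      have h2 := hdn x y hx hxy (hy.trans hut)
      rw [Real.dist_eq, abs_le] at h2
      rw [← sub_div, le_div_iff₀ hc0]
      refine abs_le_of_sq_le_sq' (a := dist (π (γ x)) (π (γ y)) * c) ?_ ?_ |>.2
      · rw [mul_pow, hc2]
        nlinarith [sq_nonneg ((d y - d x) - κ * (y - x)), mul_le_mul_of_nonneg_left h1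
          (show 0 ≤ 1 - κ ^ 2 by nlinarith)]
      · nlinarith)
    (fun x hx => hπF _ (h.mem x ⟨hs.trans hx.1, hx.2.trans (hut.trans ht)⟩))
  -- On `[u, t]` it suffices that projecting does not lengthen; the strict gain comes from `[s, u]`.
  have hJ' := JoinedWithin.of_nonexpansiveOn (F := F) (f := fun v => π (γ v)) hut
    (fun x y hx hxy hy => by
      refine abs_le_of_sq_le_sq' ?_ (sub_nonneg.2 hxy) |>.2
      nlinarith [hkey x y (hsu.trans hx) hxy hy, sq_nonneg (d x - d y)])
    (fun x hx => hπF _ (h.mem x ⟨hs.trans (hsu.trans hx.1), hx.2.trans ht⟩))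
  have htot := hJ.trans hJ'
  simp only [hfix _ hγs, hfix _ hγt] at htot
  have hle := h.sub_le hs (hsu.trans hut) ht htot
  have hlt : (u - κ * d u) / c - (s - κ * d s) / c < ℓ := by
    rw [← sub_div, hds, div_lt_iff₀ hc0, ← hmdef]
    refine lt_of_pow_lt_pow_left₀ 2 (by positivity) ?_
    rw [mul_pow, hc2, hmκ]
    have : u - κ * (2 * κ * ℓ) - (s - κ * 0) = ℓ * (1 - 2 * κ ^ 2) := by rw [hℓ]; ring
    rw [this, mul_pow]
    have : (1 - 2 * κ ^ 2) ^ 2 < 1 - κ ^ 2 := by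
      nlinarith [mul_pos hκ0 hκ0, mul_pos (mul_pos hκ0 hκ0) (show 0 < 3 - 4 * κ ^ 2 by nlinarith)]
    gcongr
  linarith

/-- A shortest curve is straight where it runs through the interior of the domain. -/
theorem exists_affine_of_mem_interior (h : IsGeodesic F γ L) {α β : ℝ} (hα : 0 ≤ α) (hαβ : α < β)
    (hβ : β ≤ L) (hF : ∀ u ∈ Ioo α β, γ u ∈ interior F) :
    ∃ w, ∀ u ∈ Icc α β, γ u = γ α + (u - α) • w := by
  have hloc : ∀ t ∈ Ioo α β, ∃ v : E, ∀ᶠ x in 𝓝 t, HasDerivAt γ v x := by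
    intro t ht
    obtain ⟨r, hr, hball⟩ := Metric.isOpen_iff.1 isOpen_interior _ (hF t ht)
    obtain ⟨δ, hδ, hδα, hδβ, hδr⟩ : ∃ δ, 0 < δ ∧ α < t - δ ∧ t + δ < β ∧ δ < r := by
      refine ⟨min (min (t - α) (β - t)) r / 2, ?_, ?_, ?_, ?_⟩
      · have := ht.1; have := ht.2
        exact half_pos (lt_min (lt_min (by linarith) (by linarith)) hr)
      · have := min_le_left (min (t - α) (β - t)) r
        have := min_le_left (t - α) (β - t)
        linarith [ht.1]
      · have := min_le_left (min (t - α) (β - t)) r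
        have := min_le_right (t - α) (β - t)
        linarith [ht.2]
      · have := min_le_right (min (t - α) (β - t)) r
        linarith
    have hmem : ∀ x ∈ Icc (t - δ) (t + δ), γ x ∈ Metric.ball (γ t) r := by
      intro x hx
      have h1 := h.nonexpansive.dist_le (x := x) (y := t) ⟨by linarith [hx.1], by linarith [hx.2]⟩
        ⟨by linarith, by linarith⟩
      have h2 : |x - t| ≤ δ := abs_le.2 ⟨by linarith [hx.1], by linarith [hx.2]⟩
      exact Metric.mem_ball.2 (by linarith)
    -- Chords within the ball are free, so distances equal parameter differences; equality in the
    -- triangle inequality then makes the curve affine near `t`.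
    have hdist : ∀ x ∈ Icc (t - δ) (t + δ), ∀ y ∈ Icc (t - δ) (t + δ), x ≤ y →
        dist (γ x) (γ y) = y - x := by
      intro x hx y hy hxy
      have h0 : 0 ≤ x := by linarith [hx.1]
      have hL : y ≤ L := by linarith [hy.2]
      exact le_antisymm (h.nonexpansive x y h0 hxy hL) (h.sub_le_dist h0 hxy hL
        (((convex_ball _ _).segment_subset (hmem x hx) (hmem y hy)).trans
          (hball.trans interior_subset)))
    have hl : t - δ ∈ Icc (t - δ) (t + δ) := ⟨le_rfl, by linarith⟩
    have hr : t + δ ∈ Icc (t - δ) (t + δ) := ⟨by linarith, le_rfl⟩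
    have hlr := hdist _ hl _ hr (by linarith)
    refine ⟨(1 / (2 * δ)) • (γ (t + δ) - γ (t - δ)), ?_⟩
    have heq : ∀ x ∈ Ioo (t - δ) (t + δ),
        γ x = γ (t - δ) + (x - (t - δ)) • ((1 / (2 * δ)) • (γ (t + δ) - γ (t - δ))) := by
      intro x hx
      have hx' := Ioo_subset_Icc_self hx
      have h1 := hdist _ hl _ hx' hx'.1
      have h2 := hdist _ hx' _ hr hx'.2
      have := eq_lineMap_of_dist_eq_mul_of_dist_eq_mul (x := γ (t - δ)) (y := γ x) (z := γ (t + δ))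
        (r := (x - (t - δ)) / (2 * δ)) (by rw [h1, hlr]; field_simp; ring)
        (by rw [h2, hlr]; field_simp; ring)
      rw [this, AffineMap.lineMap_apply, vsub_eq_sub, vadd_eq_add, add_comm, smul_smul,
        div_eq_mul_one_div]
    filter_upwards [isOpen_Ioo.mem_nhds (show t ∈ Ioo (t - δ) (t + δ) from
      ⟨by linarith, by linarith⟩)] with x hx
    have hev : γ =ᶠ[𝓝 x] fun x =>
        γ (t - δ) + (x - (t - δ)) • ((1 / (2 * δ)) • (γ (t + δ) - γ (t - δ))) := by
      filter_upwards [isOpen_Ioo.mem_nhds hx] with y hy using heq y hy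
    refine HasDerivAt.congr_of_eventuallyEq ?_ hev
    simpa using (((hasDerivAt_id x).sub_const (t - δ)).smul_const
      ((1 / (2 * δ)) • (γ (t + δ) - γ (t - δ)))).const_add (γ (t - δ))
  -- Local affinity becomes global on the connected interval: the derivative is locally constant,
  -- hence constant.
  have hd2 : ∀ t ∈ Ioo α β, HasDerivAt (deriv γ) 0 t := by
    intro t ht
    obtain ⟨v, hv⟩ := hloc t ht
    refine (hasDerivAt_const t v).congr_of_eventuallyEq ?_
    filter_upwards [hv] with x hx using hx.deriv
  obtain ⟨w, hw⟩ := isOpen_Ioo.exists_is_const_of_deriv_eq_zero isPreconnected_Ioo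
    (fun t ht => (hd2 t ht).differentiableAt.differentiableWithinAt)
    (fun t ht => (hd2 t ht).deriv)
  have hγ1 : ∀ t ∈ Ioo α β, HasDerivAt (fun u => γ u - (u - α) • w) 0 t := by
    intro t ht
    obtain ⟨v, hv⟩ := hloc t ht
    have h1 := hv.self_of_nhds
    have h2 : v = w := by rw [← hw t ht, h1.deriv]
    have := h1.fun_sub (((hasDerivAt_id t).sub_const α).smul_const w)
    simpa [h2] using this
  obtain ⟨c, hcst⟩ := isOpen_Ioo.exists_is_const_of_deriv_eq_zero isPreconnected_Ioo
    (fun t ht => (hγ1 t ht).differentiableAt.differentiableWithinAt)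
    (fun t ht => (hγ1 t ht).deriv)
  have hcont : ContinuousOn (fun u => γ u - (u - α) • w) (Icc α β) :=
    (h.nonexpansive.continuousOn.mono (Icc_subset_Icc hα hβ)).sub (by fun_prop)
  have hall : EqOn (fun u => γ u - (u - α) • w) (fun _ => c) (Icc α β) := by
    have h1 : EqOn (fun u => γ u - (u - α) • w) (fun _ => c) (Ioo α β) := hcst
    exact h1.of_subset_closure hcont continuousOn_const Ioo_subset_Icc_self
      (closure_Ioo hαβ.ne).ge
  refine ⟨w, fun u hu => ?_⟩
  have h1 := hall hu
  have h2 := hall (left_mem_Icc.2 hαβ.le)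
  simp only [sub_self, zero_smul, sub_zero] at h1 h2
  rw [h2, ← h1]
  abel

end IsGeodesic

end InnerProduct

/-! ### Inflated obstacles, their normals, and tangential contact -/

namespace Environment

variable {W : Environment} {k l : Fin W.N} {p q n v w x y : Plane}

theorem isCompact_obstacle : IsCompact (W.obstacle k) :=
  (W.vertices k).finite_toSet.isCompact_convexHull (𝕜 := ℝ)

theorem convex_obstacle : Convex ℝ (W.obstacle k) := convex_convexHull ℝ _

theorem obstacle_nonempty : (W.obstacle k).Nonempty :=
  convexHull_nonempty_iff.2 (W.vertices_nonempty k)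

theorem isCompact_inflated : IsCompact (W.inflated k) :=
  isCompact_obstacle.add (isCompact_closedBall _ _)

theorem convex_inflated : Convex ℝ (W.inflated k) :=
  convex_obstacle.add (convex_closedBall _ _)

theorem mem_inflated : x ∈ W.inflated k ↔ ∃ o ∈ W.obstacle k, ‖x - o‖ ≤ W.ρ := by
  constructor
  · rintro ⟨o, ho, e, he, rfl⟩
    exact ⟨o, ho, by simpa using he⟩
  · rintro ⟨o, ho, h⟩
    exact ⟨o, ho, x - o, by simpa using h, by simp⟩

theorem mem_interior_inflated {o : Plane} (ho : o ∈ W.obstacle k) (h : ‖x - o‖ < W.ρ) :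
    x ∈ interior (W.inflated k) := by
  refine mem_interior.2 ⟨Metric.ball o W.ρ, fun y hy => mem_inflated.2 ⟨o, ho, ?_⟩,
    Metric.isOpen_ball, by simpa [dist_eq_norm] using h⟩
  rw [← dist_eq_norm]
  exact (Metric.mem_ball.1 hy).le

theorem interior_inflated_nonempty : (interior (W.inflated k)).Nonempty := by
  obtain ⟨o, ho⟩ := W.obstacle_nonempty (k := k)
  exact ⟨o, mem_interior_inflated ho (by simpa using W.ρ_pos)⟩

theorem isClosed_free : IsClosed W.free := by
  have : W.free = ⋂ k, (interior (W.inflated k))ᶜ := by ext; simp [free]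
  rw [this]
  exact isClosed_iInter fun k => isOpen_interior.isClosed_compl

/-- The interior of an inflated obstacle is dense in it, so another interior containing one of its
points would meet its interior. Thus each whole boundary is available to paths. -/
theorem mem_free_of_mem_inflated (hx : x ∈ W.inflated k) (hx' : x ∉ interior (W.inflated k)) :
    x ∈ W.free := by
  intro l hl
  rcases eq_or_ne k l with rfl | hkl
  · exact hx' hl
  have hcl : x ∈ closure (interior (W.inflated k)) := by
    rw [convex_inflated.closure_interior_eq_closure_of_nonempty_interior interior_inflated_nonempty]
    exact subset_closure hx
  obtain ⟨z, hzl, hzk⟩ := mem_closure_iff.1 hcl _ isOpen_interior hl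
  exact (Set.disjoint_left.1 (W.nonoverlapping k l hkl)) hzk hzl

theorem mem_interior_free (h : ∀ k, x ∉ W.inflated k) : x ∈ interior W.free := by
  have ho : IsOpen (⋂ k, (W.inflated k)ᶜ) :=
    isOpen_iInter_of_finite fun k => isCompact_inflated.isClosed.isOpen_compl
  refine mem_interior.2 ⟨⋂ k, (W.inflated k)ᶜ,
    fun y hy k hk => mem_iInter.1 hy k (interior_subset hk), ho, ?_⟩
  simpa using h

/-- A point outside the interior of an inflated obstacle is separated from it by a line that touches
a disc of radius `ρ` centred in the obstacle. -/
theorem exists_separating (hq : q ∉ interior (W.inflated k)) :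
    ∃ o ∈ W.obstacle k, ∃ n : Plane, ‖n‖ = 1 ∧ q = o + ‖q - o‖ • n ∧ W.ρ ≤ ‖q - o‖ ∧
      ∀ x ∈ W.inflated k, ⟪n, x - o⟫ ≤ W.ρ := by
  -- The nearest point is taken in the uninflated obstacle; this makes the normal point away from
  -- the centre of a disc of radius `ρ`.
  obtain ⟨π, hπ⟩ := exists_convex_projection obstacle_nonempty
    (isCompact_obstacle (W := W) (k := k)).isComplete convex_obstacle
  obtain ⟨ho, hle⟩ := hπ q
  set o := π q
  have hρ : W.ρ ≤ ‖q - o‖ := not_lt.1 fun h => hq (mem_interior_inflated ho h)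
  have hpos : 0 < ‖q - o‖ := W.ρ_pos.trans_le hρ
  have hn : ‖(‖q - o‖⁻¹ • (q - o))‖ = 1 := by
    rw [norm_smul, norm_inv, norm_norm, inv_mul_cancel₀ hpos.ne']
  refine ⟨o, ho, ‖q - o‖⁻¹ • (q - o), hn, ?_, hρ, ?_⟩
  · rw [smul_smul, mul_inv_cancel₀ hpos.ne', one_smul, add_sub_cancel]
  · intro x hx
    obtain ⟨o', ho', hx'⟩ := mem_inflated.1 hx
    have h1 : ⟪‖q - o‖⁻¹ • (q - o), o' - o⟫ ≤ 0 := by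
      rw [real_inner_smul_left]
      exact mul_nonpos_of_nonneg_of_nonpos (by positivity) (hle o' ho')
    have h2 := real_inner_le_norm (‖q - o‖⁻¹ • (q - o)) (x - o')
    rw [hn, one_mul] at h2
    have h3 : x - o = (x - o') + (o' - o) := by abel
    rw [h3, inner_add_right]
    linarith

/-- `n` is the outer unit normal of the `k`-th inflated obstacle at its boundary point `p`. -/
structure HasNormal (W : Environment) (k : Fin W.N) (p n : Plane) : Prop where
  norm_eq_one : ‖n‖ = 1
  center_mem : p - W.ρ • n ∈ W.obstacle k
  inner_le : ∀ x ∈ W.inflated k, ⟪n, x - p⟫ ≤ 0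

theorem exists_hasNormal (hp : p ∈ W.inflated k) (hp' : p ∉ interior (W.inflated k)) :
    ∃ n, W.HasNormal k p n := by
  obtain ⟨o, ho, n, hn, hpo, hρ, hle⟩ := exists_separating hp'
  have hle' := hle p hp
  have h1 : p - o = ‖p - o‖ • n := by
    nth_rewrite 1 [hpo]; abel
  rw [h1, inner_smul_right, real_inner_self_eq_norm_sq, hn] at hle'
  have h2 : ‖p - o‖ = W.ρ := by linarith
  rw [h2] at h1 hpo
  refine ⟨n, hn, by rw [← h1]; simpa using ho, fun x hx => ?_⟩
  have h3 : x - p = (x - o) - (p - o) := by abel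
  rw [h3, inner_sub_right, h1, inner_smul_right, real_inner_self_eq_norm_sq, hn]
  linarith [hle x hx]

namespace HasNormal

theorem ne_zero (h : W.HasNormal k p n) : n ≠ 0 := by
  rintro rfl
  simpa using h.norm_eq_one

theorem inner_neg (h : W.HasNormal k p n) (hx : x ∈ interior (W.inflated k)) : ⟪n, x - p⟫ < 0 := by
  have := inner_lt_of_mem_interior (c := ⟪n, p⟫) h.ne_zero (fun y hy => by
    have := h.inner_le y hy; rw [inner_sub_right] at this; linarith) hx
  rw [inner_sub_right]
  linarith

theorem mem (h : W.HasNormal k p n) : p ∈ W.inflated k :=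
  mem_inflated.2 ⟨_, h.center_mem, by simp [norm_smul, h.norm_eq_one, abs_of_pos W.ρ_pos]⟩

theorem tangentAt (h : W.HasNormal k p n) (hv : v ≠ 0) (hnv : ⟪n, v⟫ = 0) :
    TangentAt (W.inflated k) p v := by
  refine ⟨hv, h.mem, fun t ht => ?_⟩
  have := h.inner_neg ht
  rw [add_sub_cancel_left, inner_smul_right, hnv, mul_zero] at this
  exact lt_irrefl _ this

/-- A free segment starting at a boundary point of an inflated obstacle does not point inwards. -/
theorem inner_nonneg (h : W.HasNormal k p n) {δ : ℝ} (hδ : 0 < δ)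
    (hfree : ∀ ε ∈ Icc 0 δ, p + ε • w ∈ W.free) : 0 ≤ ⟪n, w⟫ := by
  by_contra! hneg
  have hρ := W.ρ_pos
  have hw : 0 < ‖w‖ ^ 2 + 1 := by positivity
  -- With $\varepsilon\|w\|^2<-2\rho\langle n,w\rangle$ the point `p + ε • w` is closer than `ρ` to
  -- the centre `p - ρ n`.
  obtain ⟨ε, hε0, hεδ, hε⟩ : ∃ ε, 0 < ε ∧ ε ≤ δ ∧ ε * (‖w‖ ^ 2 + 1) ≤ W.ρ * (-⟪n, w⟫) := by
    have h1 : 0 < W.ρ * (-⟪n, w⟫) := mul_pos hρ (by linarith)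
    refine ⟨min δ (W.ρ * (-⟪n, w⟫) / (‖w‖ ^ 2 + 1)), lt_min hδ (by positivity), min_le_left _ _, ?_⟩
    rw [← le_div_iff₀ hw]
    exact min_le_right _ _
  refine hfree ε ⟨hε0.le, hεδ⟩ k (mem_interior_inflated h.center_mem ?_)
  have h1 : p + ε • w - (p - W.ρ • n) = W.ρ • n + ε • w := by abel
  rw [h1]
  refine lt_of_pow_lt_pow_left₀ 2 hρ.le ?_
  rw [norm_add_sq_real, norm_smul, norm_smul, h.norm_eq_one, inner_smul_left, inner_smul_right,
    Real.norm_eq_abs, Real.norm_eq_abs, abs_of_pos hρ, abs_of_pos hε0]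
  simp only [conj_trivial]
  nlinarith [mul_pos hε0 hε0, mul_le_mul_of_nonneg_left hε hε0.le,
    mul_pos hε0 (mul_pos hρ (neg_pos.2 hneg))]

/-- At a common boundary point, two different inflated obstacles have opposite normals. -/
theorem eq_neg (h : W.HasNormal k p n) {n' : Plane} (h' : W.HasNormal l p n') (hkl : k ≠ l) :
    n' = -n := by
  have hρ := W.ρ_pos
  by_contra hne
  have hpos : 0 < ‖n + n'‖ := norm_pos_iff.2 fun h0 => hne (eq_neg_of_add_eq_zero_right h0)
  have hlt : ‖n - n'‖ < 2 := by
    have := parallelogram_law_with_norm ℝ n n'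
    rw [h.norm_eq_one, h'.norm_eq_one] at this
    nlinarith [norm_nonneg (n - n')]
  -- The midpoint of the two disc centres has distance $\rho\|n-n'\|/2<\rho$ from each, so it lies
  -- in both interiors.
  refine Set.disjoint_left.1 (W.nonoverlapping k l hkl)
    (mem_interior_inflated (x := p - (W.ρ / 2) • (n + n')) h.center_mem ?_)
    (mem_interior_inflated h'.center_mem ?_)
  · have : p - (W.ρ / 2) • (n + n') - (p - W.ρ • n) = (W.ρ / 2) • (n - n') := by module
    rw [this, norm_smul, Real.norm_eq_abs, abs_of_pos (by positivity)]
    nlinarith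
  · have : p - (W.ρ / 2) • (n + n') - (p - W.ρ • n') = -((W.ρ / 2) • (n - n')) := by module
    rw [this, norm_neg, norm_smul, Real.norm_eq_abs, abs_of_pos (by positivity)]
    nlinarith

end HasNormal

/-- A shortest curve leaves an inflated obstacle tangentially. -/
theorem inner_eq_zero_of_isGeodesic {γ : ℝ → Plane} {L t t' : ℝ} (h : IsGeodesic W.free γ L)
    (ht : 0 < t) (htt' : t < t') (ht' : t' ≤ L) (hw : ∀ u ∈ Icc t t', γ u = γ t + (u - t) • w)
    (hn : W.HasNormal k (γ t) n) : ⟪n, w⟫ = 0 := by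
  have hρ := W.ρ_pos
  set p := γ t with hp
  have hpF : p ∈ W.free := h.mem t ⟨ht.le, by linarith⟩
  have hfree : ∀ ε ∈ Icc 0 (t' - t), p + ε • w ∈ W.free := by
    intro ε hε
    have := hw (t + ε) ⟨by linarith [hε.1], by linarith [hε.2]⟩
    rw [add_sub_cancel_left] at this
    rw [← this]
    exact h.mem _ ⟨by linarith [hε.1], by linarith [hε.2]⟩
  have hnonneg := hn.inner_nonneg (sub_pos.2 htt') hfree
  by_contra hne
  -- If the curve left at a positive angle, no other obstacle would be near `p`, and the corner at
  -- `p` could be cut by the chord from `γ (t - ε)` to `γ (t + ε)`.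
  set a := ⟪n, w⟫ with ha
  have hapos : 0 < a := lt_of_le_of_ne hnonneg (Ne.symm hne)
  have honly : ∀ l, l ≠ k → p ∉ W.inflated l := by
    intro l hl hpl
    obtain ⟨n', hn'⟩ := exists_hasNormal hpl (hpF l)
    have h1 := hn'.inner_nonneg (sub_pos.2 htt') hfree
    rw [hn.eq_neg hn' hl.symm, inner_neg_left] at h1
    linarith
  obtain ⟨r, hr, hball⟩ : ∃ r > 0, ∀ x ∈ Metric.ball p r, ∀ l, l ≠ k → x ∉ W.inflated l := by
    have ho : IsOpen (⋂ l, ⋂ (_ : l ≠ k), (W.inflated l)ᶜ) :=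
      isOpen_iInter_of_finite fun l => isOpen_iInter_of_finite fun _ =>
        isCompact_inflated.isClosed.isOpen_compl
    obtain ⟨r, hr, hsub⟩ := Metric.isOpen_iff.1 ho p (by simpa using honly)
    refine ⟨r, hr, fun x hx l hl => ?_⟩
    have := hsub hx
    simp only [mem_iInter, mem_compl_iff] at this
    exact this l hl
  obtain ⟨ε, hε0, hεt, hεt', hεr, hεa⟩ : ∃ ε, 0 < ε ∧ ε ≤ t ∧ ε ≤ t' - t ∧ ε < r ∧
      8 * ε ≤ W.ρ * a ^ 2 := by
    refine ⟨min (min t (t' - t)) (min (r / 2) (W.ρ * a ^ 2 / 8)), ?_, ?_, ?_, ?_, ?_⟩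
    · exact lt_min (lt_min ht (by linarith)) (lt_min (by linarith) (by positivity))
    · exact (min_le_left _ _).trans (min_le_left _ _)
    · exact (min_le_left _ _).trans (min_le_right _ _)
    · have := (min_le_right (min t (t' - t)) (min (r / 2) (W.ρ * a ^ 2 / 8))).trans (min_le_left _ _)
      linarith
    · have := (min_le_right (min t (t' - t)) (min (r / 2) (W.ρ * a ^ 2 / 8))).trans (min_le_right _ _)
      linarith
  set q := γ (t - ε) with hq
  have hqF : q ∈ W.free := h.mem _ ⟨by linarith, by linarith⟩
  have hz : γ (t + ε) = p + ε • w := by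
    rw [hw (t + ε) ⟨by linarith, by linarith⟩, add_sub_cancel_left]
  set z := γ (t + ε) with hzdef
  have hqp : dist q p ≤ ε := by
    have := h.nonexpansive (t - ε) t (by linarith) (by linarith) (by linarith)
    linarith
  have hpz : dist p z ≤ ε := by
    have := h.nonexpansive t (t + ε) (by linarith) (by linarith) (by linarith)
    linarith
  -- A half-plane containing `q` and `z`, with the obstacle on the other side, makes the chord free.
  -- If `q` is beyond the tangent line at `p`, the normal `n` serves. Otherwise the normal `m`
  -- separating `q` serves: it satisfies $\|m-n\|^2\le 2\varepsilon/\rho\le a^2/4$, which is why `8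
  -- * ε ≤ W.ρ * a ^ 2` was required.
  obtain ⟨m, c, hm0, hmK, hmq, hmz, hmw⟩ : ∃ (m : Plane) (c : ℝ), m ≠ 0 ∧
      (∀ x ∈ W.inflated k, ⟪m, x⟫ ≤ c) ∧ c ≤ ⟪m, q⟫ ∧ c ≤ ⟪m, z⟫ ∧ 0 < ⟪m, w⟫ := by
    rcases le_total 0 ⟪n, q - p⟫ with hqn | hqn
    · refine ⟨n, ⟪n, p⟫, hn.ne_zero, fun x hx => ?_, ?_, ?_, hapos⟩
      · have := hn.inner_le x hx
        rw [inner_sub_right] at this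
        linarith
      · rw [inner_sub_right] at hqn
        linarith
      · rw [hz, inner_add_right, inner_smul_right]
        have := mul_pos hε0 hapos
        linarith
    · obtain ⟨o, ho, m, hm, hqo, hρo, hle⟩ := exists_separating (hqF k)
      have hw1 : ε * ‖w‖ ≤ ε := by
        rw [dist_eq_norm, hz, sub_add_cancel_left, norm_neg, norm_smul, Real.norm_eq_abs,
          abs_of_pos hε0] at hpz
        exact hpz
      have hw2 : ‖w‖ ≤ 1 := by
        by_contra! hcon
        nlinarith
      have hqm : W.ρ ≤ ⟪m, q - o⟫ := by
        have : q - o = ‖q - o‖ • m := by nth_rewrite 1 [hqo]; abel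
        rw [this, inner_smul_right, real_inner_self_eq_norm_sq, hm]
        linarith
      have hcen : ⟪m, p - W.ρ • n - o⟫ ≤ 0 := by
        have hmem : p - W.ρ • n + W.ρ • m ∈ W.inflated k :=
          mem_inflated.2 ⟨_, hn.center_mem, by simp [norm_smul, hm, abs_of_pos hρ]⟩
        have h1 := hle _ hmem
        have h2 : p - W.ρ • n + W.ρ • m - o = (p - W.ρ • n - o) + W.ρ • m := by abel
        rw [h2, inner_add_right, inner_smul_right, real_inner_self_eq_norm_sq, hm] at h1
        linarith
      have hqp' : |⟪m, p - q⟫| ≤ ε := by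
        have := abs_real_inner_le_norm m (p - q)
        rw [hm, one_mul, ← dist_eq_norm, dist_comm] at this
        linarith
      have hmn : W.ρ - ε ≤ W.ρ * ⟪m, n⟫ := by
        have h2 : p - W.ρ • n - o = (p - q) + (q - o) - W.ρ • n := by abel
        rw [h2, inner_sub_right, inner_add_right, inner_smul_right] at hcen
        linarith [(abs_le.1 hqp').1]
      have hdist : ‖m - n‖ ≤ a / 2 := by
        have h1 : ‖m - n‖ ^ 2 = 2 - 2 * ⟪m, n⟫ := by
          rw [norm_sub_sq_real, hm, hn.norm_eq_one]; ring
        refine le_of_sq_le_sq ?_ (by positivity)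
        rw [h1]
        have : W.ρ * (2 - 2 * ⟪m, n⟫) ≤ W.ρ * (a / 2) ^ 2 := by linarith
        exact le_of_mul_le_mul_left this hρ
      have hmw : a / 2 ≤ ⟪m, w⟫ := by
        have h1 := abs_real_inner_le_norm (m - n) w
        have h2 : ‖m - n‖ * ‖w‖ ≤ a / 2 * 1 := by gcongr
        rw [inner_sub_left] at h1
        linarith [(abs_le.1 (h1.trans h2)).1]
      have hmpq : -(ε * (a / 2)) ≤ ⟪m, p - q⟫ := by
        have h1 := abs_real_inner_le_norm (m - n) (p - q)
        have h2 : ‖m - n‖ * ‖p - q‖ ≤ a / 2 * ε := by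
          rw [← dist_eq_norm p q, dist_comm]
          gcongr
        rw [inner_sub_left] at h1
        have h3 : ⟪n, p - q⟫ = -⟪n, q - p⟫ := by rw [← inner_neg_right, neg_sub]
        linarith [(abs_le.1 (h1.trans h2)).1]
      refine ⟨m, ⟪m, o⟫ + W.ρ, by rintro rfl; simp at hm, fun x hx => ?_, ?_, ?_, by linarith⟩
      · have := hle x hx
        rw [inner_sub_right] at this
        linarith
      · rw [inner_sub_right] at hqm
        linarith
      · rw [inner_sub_right] at hqm hmpq
        rw [hz, inner_add_right, inner_smul_right]
        have := mul_le_mul_of_nonneg_left hmw hε0.le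
        linarith
  have hseg : segment ℝ q z ⊆ W.free := by
    intro x hx l hxl
    by_cases hl : l = k
    · subst hl
      have h1 := inner_lt_of_mem_interior hm0 hmK hxl
      have h2 : Convex ℝ {x : Plane | c ≤ ⟪m, x⟫} :=
        convex_halfSpace_ge (f := fun x => ⟪m, x⟫) (innerSL ℝ m).isBoundedLinearMap.toIsLinearMap c
      have h3 : c ≤ ⟪m, x⟫ := h2.segment_subset hmq hmz hx
      linarith
    · refine hball x ((convex_ball p r).segment_subset ?_ ?_ hx) l hl (interior_subset hxl)
      · exact Metric.mem_ball.2 (by linarith)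
      · exact Metric.mem_ball.2 (by rw [dist_comm]; linarith)
  have hlen := h.sub_le_dist (by linarith) (by linarith) (by linarith) hseg
  have htri := dist_triangle q p z
  -- Minimality forces equality in the triangle inequality, so `p - q = ε • w`. Then `p` lies
  -- strictly further along `m` than `q`, although it belongs to the obstacle.
  have hmid : p = AffineMap.lineMap q z (1 / 2 : ℝ) := by
    apply eq_lineMap_of_dist_eq_mul_of_dist_eq_mul <;> linarith
  have hpq : p - q = ε • w := by
    rw [AffineMap.lineMap_apply, vsub_eq_sub, vadd_eq_add] at hmid
    have h1 : (2 : ℝ) • p = q + z := by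
      rw [hmid]; module
    have h2 : p - q = z - p := by
      rw [two_smul] at h1
      exact sub_eq_sub_iff_add_eq_add.2 (by rw [h1, add_comm])
    rw [h2, hz, add_sub_cancel_left]
  have h1 := hmK p hn.mem
  have h2 : ⟪m, p - q⟫ = ε * ⟪m, w⟫ := by rw [hpq, inner_smul_right]
  rw [inner_sub_right] at h2
  have h3 := mul_pos hε0 hmw
  linarith

end Environment

/-- Increasing enumeration of a finite set, with the index clamped at `n` to give a monotone
sequence on all of `ℕ`. -/
theorem Finset.exists_monotone_partition (S : Finset ℝ) {a b : ℝ} (ha : a ∈ S) (hb : b ∈ S)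
    (hS : ∀ x ∈ S, a ≤ x ∧ x ≤ b) :
    ∃ (n : ℕ) (t : ℕ → ℝ), Monotone t ∧ t 0 = a ∧ t n = b ∧
      ∀ m < n, t m ∈ S ∧ t (m + 1) ∈ S ∧ t m < t (m + 1) ∧ ∀ x ∈ S, x ≤ t m ∨ t (m + 1) ≤ x := by
  obtain ⟨n, hn⟩ : ∃ n, S.card = n + 1 :=
    Nat.exists_eq_succ_of_ne_zero (Finset.card_pos.2 ⟨a, ha⟩).ne'
  set e := S.orderEmbOfFin hn
  have hmem : ∀ i, e i ∈ S := S.orderEmbOfFin_mem hn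
  have hsurj : ∀ x ∈ S, ∃ i, e i = x := by
    intro x hx
    have := S.range_orderEmbOfFin hn
    rw [← Finset.mem_coe, ← this] at hx
    exact hx
  refine ⟨n, fun m => e ⟨min m n, by omega⟩, fun i j hij => e.monotone ?_, ?_, ?_, ?_⟩
  · exact Fin.mk_le_mk.2 (min_le_min_right n hij)
  · obtain ⟨i, hi⟩ := hsurj a ha
    refine le_antisymm ?_ (hS _ (hmem _)).1
    rw [← hi]
    exact e.monotone (Fin.mk_le_of_le_val (by simp))
  · obtain ⟨i, hi⟩ := hsurj b hb
    refine le_antisymm (hS _ (hmem _)).2 ?_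
    rw [← hi]
    exact e.monotone (Fin.le_def.2 (by simp; omega))
  · intro m hm
    refine ⟨hmem _, hmem _, e.strictMono (Fin.mk_lt_mk.2 (by omega)), fun x hx => ?_⟩
    obtain ⟨i, rfl⟩ := hsurj x hx
    rcases Nat.lt_or_ge m i with h | h
    · exact .inr (e.monotone (Fin.le_def.2 (by simp; omega)))
    · exact .inl (e.monotone (Fin.le_def.2 (by simp; omega)))

/-! ### Decomposition of a geodesic into edges of the tangent graph -/

namespace Environment

variable {W : Environment} {γ : ℝ → Plane} {L : ℝ} {a b p q : Plane}

theorem tangentAt_singleton {v : Plane} (hv : v ≠ 0) : TangentAt {p} p v :=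
  ⟨hv, rfl, fun t ht => by simp at ht⟩

theorem IsCommonTangent.symm {i j : Fin W.N ⊕ Bool} (h : W.IsCommonTangent a b i j p q) :
    W.IsCommonTangent a b j i q p := by
  obtain ⟨hij, v, hp, hq, t, rfl⟩ := h
  exact ⟨hij.symm, v, hq, hp, -t, by module⟩

theorem isCommonTangent_terminals : W.IsCommonTangent a b (.inr false) (.inr true) a b := by
  rcases eq_or_ne a b with rfl | hab
  · obtain ⟨v, hv⟩ := exists_ne (0 : Plane)
    exact ⟨by simp, v, tangentAt_singleton hv, tangentAt_singleton hv, 0, by simp⟩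
  · have hv := sub_ne_zero.2 hab.symm
    exact ⟨by simp, b - a, tangentAt_singleton hv, tangentAt_singleton hv, 1, by simp⟩

theorem isNode_left : W.IsNode a b a := ⟨_, _, _, isCommonTangent_terminals⟩

theorem isNode_right : W.IsNode a b b := ⟨_, _, _, isCommonTangent_terminals.symm⟩

/-- A common boundary point of two different inflated obstacles is a node. -/
theorem isNode_of_mem_inflated {k l : Fin W.N} (hkl : k ≠ l) (hp : p ∈ W.free)
    (hk : p ∈ W.inflated k) (hl : p ∈ W.inflated l) : W.IsNode a b p := by
  obtain ⟨n, hn⟩ := exists_hasNormal hk (hp k)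
  obtain ⟨n', hn'⟩ := exists_hasNormal hl (hp l)
  obtain ⟨v, hv, hnv⟩ : ∃ v : Plane, v ≠ 0 ∧ ⟪n, v⟫ = 0 := by
    refine ⟨!₂[-n 1, n 0], fun h0 => hn.ne_zero ?_, ?_⟩
    · have h1 := congrArg (fun x : Plane => x 0) h0
      have h2 := congrArg (fun x : Plane => x 1) h0
      ext i
      fin_cases i
      · simpa using h2
      · simpa using h1
    · simp [PiLp.inner_apply, Fin.sum_univ_two]
      ring
  -- The normals are opposite, so the line orthogonal to `n` is tangent to both bodies at `p`; the
  -- common tangent segment has length zero.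
  refine ⟨.inl k, .inl l, p, by simpa using hkl, v, hn.tangentAt hv hnv, hn'.tangentAt hv ?_, 0,
    by simp⟩
  rw [hn.eq_neg hn' hkl, inner_neg_left, hnv, neg_zero]

theorem mem_inflated_of_isGeodesic (h : IsGeodesic W.free γ L) {k : Fin W.N} {s u t : ℝ}
    (hs : 0 ≤ s) (hsu : s ≤ u) (hut : u ≤ t) (ht : t ≤ L) (hγs : γ s ∈ W.inflated k)
    (hγt : γ t ∈ W.inflated k) : γ u ∈ W.inflated k :=
  h.mem_of_convex isCompact_inflated.isComplete convex_inflated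
    (fun _ => mem_free_of_mem_inflated) (fun _ hx => hx k) hs hsu hut ht hγs hγt

/-- Between two inflated obstacles, or a terminal, a shortest curve follows a common tangent. -/
theorem isTangentEdge_of_isGeodesic (h : IsGeodesic W.free γ L) {α β : ℝ} (hα : 0 ≤ α)
    (hαβ : α < β) (hβ : β ≤ L) (hfree : ∀ u ∈ Ioo α β, ∀ k, γ u ∉ W.inflated k)
    (hl : α = 0 ∨ ∃ k, γ α ∈ W.inflated k) (hr : β = L ∨ ∃ k, γ β ∈ W.inflated k) :
    W.IsTangentEdge (γ 0) (γ L) γ α β := by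
  obtain ⟨w, hw⟩ := h.exists_affine_of_mem_interior hα hαβ hβ
    fun u hu => mem_interior_free (hfree u hu)
  have hβw := hw β ⟨hαβ.le, le_rfl⟩
  have hw0 : w ≠ 0 := by
    rintro rfl
    rw [smul_zero, add_zero] at hβw
    exact hαβ.ne' (h.injOn ⟨hα.trans hαβ.le, hβ⟩ ⟨hα, hαβ.le.trans hβ⟩ hβw)
  have hi : ∃ i, TangentAt (W.body (γ 0) (γ L) i) (γ α) w ∧
      (i = .inr false ∨ ∃ k, i = .inl k ∧ γ α ∈ W.inflated k) := by
    rcases hα.eq_or_lt with h0 | hα0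
    · subst h0
      exact ⟨.inr false, tangentAt_singleton hw0, .inl rfl⟩
    obtain ⟨k, hk⟩ := hl.resolve_left hα0.ne'
    obtain ⟨n, hn⟩ := exists_hasNormal hk (h.mem α ⟨hα, hαβ.le.trans hβ⟩ k)
    exact ⟨.inl k, hn.tangentAt hw0 (inner_eq_zero_of_isGeodesic h hα0 hαβ hβ hw hn),
      .inr ⟨k, rfl, hk⟩⟩
  have hj : ∃ j, TangentAt (W.body (γ 0) (γ L) j) (γ β) w ∧
      (j = .inr true ∨ ∃ k, j = .inl k ∧ γ β ∈ W.inflated k) := by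
    rcases hβ.eq_or_lt with h0 | hβ0
    · subst h0
      exact ⟨.inr true, tangentAt_singleton hw0, .inl rfl⟩
    obtain ⟨k, hk⟩ := hr.resolve_left hβ0.ne
    obtain ⟨n, hn⟩ := exists_hasNormal hk (h.mem β ⟨hα.trans hαβ.le, hβ⟩ k)
    -- Arrival at `γ β` is departure for the reversed curve, with direction `-w`.
    have h1 := inner_eq_zero_of_isGeodesic (W := W) (k := k) (n := n) (w := -w) (t := L - β)
      (t' := L - α) h.reverse (by linarith) (by linarith) (by linarith) (fun u hu => by
        simp only [sub_sub_cancel]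
        rw [hw (L - u) ⟨by linarith [hu.2], by linarith [hu.1]⟩, hβw]
        module) (by simpa using hn)
    rw [inner_neg_right, neg_eq_zero] at h1
    exact ⟨.inl k, hn.tangentAt hw0 h1, .inr ⟨k, rfl, hk⟩⟩
  obtain ⟨i, hiT, hi⟩ := hi
  obtain ⟨j, hjT, hj⟩ := hj
  refine ⟨⟨i, j, ?_, w, hiT, hjT, β - α, hβw⟩, w, hw⟩
  -- The two bodies differ: with both ends on one obstacle, the geodesic would stay in it between
  -- them.
  rintro rfl
  rcases hi with rfl | ⟨k, rfl, hk⟩ <;> rcases hj with hj | ⟨k', hk', hk''⟩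
  · simp at hj
  · simp at hk'
  · simp at hj
  · obtain rfl := Sum.inl_injective hk'
    exact hfree ((α + β) / 2) ⟨by linarith, by linarith⟩ k
      (mem_inflated_of_isGeodesic h hα (by linarith) (by linarith) hβ hk hk'')

/-- A shortest curve in the free region is a concatenation of finitely many edges of the tangent
graph. -/
theorem exists_edges_of_isGeodesic (h : IsGeodesic W.free γ L) :
    ∃ (n : ℕ) (t : ℕ → ℝ), Monotone t ∧ t 0 = 0 ∧ t n = L ∧
      ∀ m < n, W.IsTangentEdge (γ 0) (γ L) γ (t m) (t (m + 1)) ∨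
        W.IsArcEdge (γ 0) (γ L) γ (t m) (t (m + 1)) := by
  classical
  set T : Fin W.N → Set ℝ := fun k => {u ∈ Icc 0 L | γ u ∈ W.inflated k} with hT
  have hTc : ∀ k, IsCompact (T k) := fun k => isCompact_Icc.of_isClosed_subset
    (h.nonexpansive.continuousOn.preimage_isClosed_of_isClosed isClosed_Icc
      isCompact_inflated.isClosed) fun u hu => hu.1
  have hTi : ∀ k, (T k).Nonempty → sInf (T k) ∈ T k := fun k => (hTc k).sInf_mem
  have hTs : ∀ k, (T k).Nonempty → sSup (T k) ∈ T k := fun k => (hTc k).sSup_mem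
  have hTle : ∀ k, ∀ u ∈ T k, sInf (T k) ≤ u ∧ u ≤ sSup (T k) := fun k u hu =>
    ⟨csInf_le (hTc k).bddBelow hu, le_csSup (hTc k).bddAbove hu⟩
  -- First and last contact times with each obstacle. An obstacle never met contributes the default
  -- value 0 of `sInf ∅` and `sSup ∅`, which is already present.
  set S : Finset ℝ := {0, L} ∪ (Finset.univ.image (fun k => sInf (T k)) ∪
    Finset.univ.image fun k => sSup (T k)) with hS
  have h0S : 0 ∈ S := by simp [hS]
  have hLS : L ∈ S := by simp [hS]
  have hiS : ∀ k, sInf (T k) ∈ S := fun k => by simp [hS]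
  have hsS : ∀ k, sSup (T k) ∈ S := fun k => by simp [hS]
  have hScases : ∀ x ∈ S, x = 0 ∨ x = L ∨ ∃ k, x ∈ T k ∧ (x = sInf (T k) ∨ x = sSup (T k)) := by
    intro x hx
    simp only [hS, Finset.mem_union, Finset.mem_insert, Finset.mem_singleton, Finset.mem_image,
      Finset.mem_univ, true_and] at hx
    rcases hx with (hx | hx) | ⟨k, rfl⟩ | ⟨k, rfl⟩
    · exact .inl hx
    · exact .inr (.inl hx)
    · rcases (T k).eq_empty_or_nonempty with he | hne
      · exact .inl (by rw [he, Real.sInf_empty])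
      · exact .inr (.inr ⟨k, hTi k hne, .inl rfl⟩)
    · rcases (T k).eq_empty_or_nonempty with he | hne
      · exact .inl (by rw [he, Real.sSup_empty])
      · exact .inr (.inr ⟨k, hTs k hne, .inr rfl⟩)
  have hSIcc : ∀ x ∈ S, 0 ≤ x ∧ x ≤ L := by
    intro x hx
    rcases hScases x hx with rfl | rfl | ⟨k, hk, -⟩
    · exact ⟨le_rfl, h.nonneg⟩
    · exact ⟨h.nonneg, le_rfl⟩
    · exact hk.1
  have hstep : ∀ α ∈ S, ∀ β ∈ S, α < β → (∀ x ∈ S, x ≤ α ∨ β ≤ x) →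
      (∃ k, Icc α β ⊆ T k) ∨ W.IsTangentEdge (γ 0) (γ L) γ α β := by
    intro α hα β hβ hαβ hgap
    by_cases hex : ∃ u ∈ Ioo α β, ∃ k, γ u ∈ W.inflated k
    · obtain ⟨u, hu, k, hk⟩ := hex
      have huT : u ∈ T k :=
        ⟨⟨(hSIcc α hα).1.trans hu.1.le, hu.2.le.trans (hSIcc β hβ).2⟩, hk⟩
      obtain ⟨h1, h2⟩ := hTle k u huT
      have h3 : sInf (T k) ≤ α := (hgap _ (hiS k)).resolve_right (by linarith [hu.2])
      have h4 : β ≤ sSup (T k) := (hgap _ (hsS k)).resolve_left (by linarith [hu.1])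
      obtain ⟨h5, h5'⟩ := hTi k ⟨u, huT⟩
      obtain ⟨h6, h6'⟩ := hTs k ⟨u, huT⟩
      exact .inl ⟨k, fun x hx => ⟨⟨h5.1.trans (h3.trans hx.1), (hx.2.trans h4).trans h6.2⟩,
        mem_inflated_of_isGeodesic h h5.1 (h3.trans hx.1) (hx.2.trans h4) h6.2 h5' h6'⟩⟩
    · push Not at hex
      refine .inr (isTangentEdge_of_isGeodesic h (hSIcc α hα).1 hαβ (hSIcc β hβ).2 hex ?_ ?_)
      · rcases hScases α hα with h1 | h1 | ⟨k, hk, -⟩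
        · exact .inl h1
        · linarith [(hSIcc β hβ).2]
        · exact .inr ⟨k, hk.2⟩
      · rcases hScases β hβ with h1 | h1 | ⟨k, hk, -⟩
        · linarith [(hSIcc α hα).1]
        · exact .inl h1
        · exact .inr ⟨k, hk.2⟩
  have hnode : ∀ x ∈ S, W.IsNode (γ 0) (γ L) (γ x) := by
    intro x hx
    by_cases hx0 : x = 0
    · rw [hx0]; exact isNode_left
    by_cases hxL : x = L
    · rw [hxL]; exact isNode_right
    obtain ⟨k, hk, hend⟩ := ((hScases x hx).resolve_left hx0).resolve_left hxL
    by_cases hother : ∃ l, k ≠ l ∧ x ∈ T l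
    · obtain ⟨l, hkl, hl⟩ := hother
      exact isNode_of_mem_inflated hkl (h.mem x hk.1) hk.2 hl.2
    push Not at hother
    have honly : ∀ l, x ∈ T l → l = k := fun l hl => by
      by_contra hne
      exact hother l (Ne.symm hne) hl
    -- Here `x` is the first or last contact with the only obstacle met at that time. The adjacent
    -- piece beyond that contact cannot lie on an obstacle, so it is a tangent edge with `γ x` as a
    -- touching point.
    rcases hend with hxi | hxs
    · have hne : (S.filter (· < x)).Nonempty :=
        ⟨0, Finset.mem_filter.2 ⟨h0S, lt_of_le_of_ne hk.1.1 (Ne.symm hx0)⟩⟩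
      obtain ⟨hαS, hαx⟩ := Finset.mem_filter.1 (Finset.max'_mem _ hne)
      rcases hstep _ hαS x hx hαx (fun y hy => by
        rcases lt_or_ge y x with hyx | hyx
        · exact .inl (Finset.le_max' _ _ (Finset.mem_filter.2 ⟨hy, hyx⟩))
        · exact .inr hyx) with ⟨l, hl⟩ | ⟨⟨i, j, hij⟩, -⟩
      · obtain rfl := honly l (hl ⟨hαx.le, le_rfl⟩)
        have := (hTle l _ (hl ⟨le_rfl, hαx.le⟩)).1
        linarith
      · exact ⟨_, _, _, hij.symm⟩
    · have hne : (S.filter (x < ·)).Nonempty :=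
        ⟨L, Finset.mem_filter.2 ⟨hLS, lt_of_le_of_ne hk.1.2 hxL⟩⟩
      obtain ⟨hβS, hxβ⟩ := Finset.mem_filter.1 (Finset.min'_mem _ hne)
      rcases hstep x hx _ hβS hxβ (fun y hy => by
        rcases lt_or_ge x y with hyx | hyx
        · exact .inr (Finset.min'_le _ _ (Finset.mem_filter.2 ⟨hy, hyx⟩))
        · exact .inl hyx) with ⟨l, hl⟩ | ⟨⟨i, j, hij⟩, -⟩
      · obtain rfl := honly l (hl ⟨le_rfl, hxβ.le⟩)
        have := (hTle l _ (hl ⟨hxβ.le, le_rfl⟩)).2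
        linarith
      · exact ⟨_, _, _, hij⟩
  obtain ⟨n, t, ht, ht0, htn, hpart⟩ := S.exists_monotone_partition h0S hLS hSIcc
  refine ⟨n, t, ht, ht0, htn, fun m hm => ?_⟩
  obtain ⟨h1, h2, h3, h4⟩ := hpart m hm
  rcases hstep _ h1 _ h2 h3 h4 with ⟨k, hk⟩ | he
  · refine .inr ⟨hnode _ h1, hnode _ h2, h.injOn.mono fun u hu => (hk hu).1, k, fun u hu => ?_⟩
    exact ⟨subset_closure (hk hu).2, h.mem u (hk hu).1 k⟩
  · exact .inl he

/-! ### Shortest graph paths as geodesics, and the exchange argument -/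

namespace TangentGraphPath

/-- A shortest curve in the free region, as a path of the tangent graph. -/
def ofIsGeodesic (h : IsGeodesic W.free γ L) (ha : γ 0 = a) (hb : γ L = b) :
    W.TangentGraphPath a b where
  len := L
  len_nonneg := h.nonneg
  curve := γ
  unit_speed := h.hasUnitSpeedOn
  curve_zero := ha
  curve_len := hb
  mem_free := h.mem
  edges := by
    subst ha hb
    exact exists_edges_of_isGeodesic h

theorem joinedWithin (P : W.TangentGraphPath a b) : JoinedWithin W.free a b P.len :=
  ⟨P.len_nonneg, P.curve, P.curve_zero, P.curve_len, P.unit_speed.nonexpansiveOn, P.mem_free⟩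

/-- The shortest paths of the tangent graph are the shortest curves in the free region. -/
theorem isShortest_iff {P : W.TangentGraphPath a b} :
    P.IsShortest ↔ IsGeodesic W.free P.curve P.len := by
  constructor
  · intro hP
    refine ⟨P.len_nonneg, P.unit_speed.nonexpansiveOn, P.mem_free, fun M hM => ?_⟩
    rw [P.curve_zero, P.curve_len] at hM
    obtain ⟨L, γ, hLM, hγ, h0, hL⟩ := hM.exists_isGeodesic isClosed_free
    exact (hP (ofIsGeodesic hγ h0 hL)).trans hLM
  · intro hP Q
    refine hP.le_of_joinedWithin _ ?_
    rw [P.curve_zero, P.curve_len]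
    exact Q.joinedWithin

/-- The unique shortest path shares with any other shortest path the whole section between two
common points. -/
theorem IsUniqueShortest.image_subset_trace {r₁₁ r₁₂ r₂₁ r₂₂ : Plane}
    {P₁ : W.TangentGraphPath r₁₁ r₁₂} {P₂ : W.TangentGraphPath r₂₁ r₂₂}
    (h₁ : P₁.IsUniqueShortest) (h₂ : P₂.IsShortest) {s t : ℝ} (hs : 0 ≤ s) (hst : s ≤ t)
    (ht : t ≤ P₁.len) (hs₂ : P₁.curve s ∈ P₂.trace) (ht₂ : P₁.curve t ∈ P₂.trace) :
    P₁.curve '' Icc s t ⊆ P₂.trace := by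
  have g₁ := isShortest_iff.1 h₁.1
  have g₂ := isShortest_iff.1 h₂
  obtain ⟨x, hx, hxs⟩ := hs₂
  obtain ⟨y, hy, hyt⟩ := ht₂
  -- The section of `P₂` between the two common points, shifted to `[s, t]` and reversed if `P₂`
  -- visits them in the opposite order. The interval fits because each section is shortest and may
  -- compete with the other.
  obtain ⟨δ, hδ, hδs, hδt, hδ₂⟩ : ∃ δ : ℝ → Plane, NonexpansiveOn δ s t ∧ δ s = P₁.curve s ∧
      δ t = P₁.curve t ∧ ∀ u ∈ Icc s t, δ u ∈ P₂.trace := by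
    have hj₁ := g₁.joinedWithin hs hst ht
    rw [← hxs, ← hyt] at hj₁
    rcases le_total x y with hxy | hxy
    · have hlen : t - s = y - x := by
        refine le_antisymm ?_ (g₂.sub_le hx.1 hxy hy.2 hj₁)
        refine g₁.sub_le hs hst ht ?_
        rw [← hxs, ← hyt]
        exact g₂.joinedWithin hx.1 hxy hy.2
      refine ⟨fun u => P₂.curve (u + (x - s)), ?_, by simpa using hxs,
        (congrArg P₂.curve (by linarith)).trans hyt,
        fun u hu => mem_image_of_mem _ ⟨by linarith [hu.1, hx.1], by linarith [hu.2, hy.2]⟩⟩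
      exact ((g₂.nonexpansive.mono hx.1 hy.2).comp_add (x - s)).mono (by linarith) (by linarith)
    · have hlen : t - s = x - y := by
        refine le_antisymm ?_ (g₂.sub_le hy.1 hxy hx.2 hj₁.symm)
        refine g₁.sub_le hs hst ht ?_
        rw [← hxs, ← hyt]
        exact (g₂.joinedWithin hy.1 hxy hx.2).symm
      refine ⟨fun u => P₂.curve (x + s - u), ?_, by simpa using hxs,
        (congrArg P₂.curve (by linarith)).trans hyt,
        fun u hu => mem_image_of_mem _ ⟨by linarith [hu.2, hy.1], by linarith [hu.1, hx.2]⟩⟩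
      exact ((g₂.nonexpansive.mono hy.1 hx.2).comp_sub_left (x + s)).mono (by linarith)
        (by linarith)
  have hδF : ∀ u ∈ Icc s t, δ u ∈ W.free := by
    intro u hu
    obtain ⟨v, hv, hvu⟩ := hδ₂ u hu
    rw [← hvu]
    exact P₂.mem_free v hv
  obtain ⟨γ', gQ, h0, hL, hγ'⟩ := g₁.splice hs hst ht hδ hδs hδt hδF
  have heq := h₁.2 (ofIsGeodesic gQ (h0.trans P₁.curve_zero) (hL.trans P₁.curve_len))
    (isShortest_iff.2 gQ)
  rintro _ ⟨u, hu, rfl⟩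
  have hu' := heq (x := u) ⟨hs.trans hu.1, hu.2.trans ht⟩
  simp only [ofIsGeodesic, hγ' hu] at hu'
  rw [← hu']
  exact hδ₂ u hu

theorem IsUniqueShortest.isPreconnected_inter {r₁₁ r₁₂ r₂₁ r₂₂ : Plane}
    {P₁ : W.TangentGraphPath r₁₁ r₁₂} {P₂ : W.TangentGraphPath r₂₁ r₂₂}
    (h₁ : P₁.IsUniqueShortest) (h₂ : P₂.IsShortest) :
    IsPreconnected (P₁.trace ∩ P₂.trace) := by
  have key : ∀ s ∈ Icc 0 P₁.len, ∀ t ∈ Icc 0 P₁.len, s ≤ t → P₁.curve s ∈ P₂.trace →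
      P₁.curve t ∈ P₂.trace → ∃ C ⊆ P₁.trace ∩ P₂.trace, P₁.curve s ∈ C ∧ P₁.curve t ∈ C ∧
        IsPreconnected C := fun s hs t ht hst hs₂ ht₂ =>
    ⟨P₁.curve '' Icc s t, subset_inter (image_mono (Icc_subset_Icc hs.1 ht.2))
      (h₁.image_subset_trace h₂ hs.1 hst ht.2 hs₂ ht₂), mem_image_of_mem _ ⟨le_rfl, hst⟩,
      mem_image_of_mem _ ⟨hst, le_rfl⟩, isPreconnected_Icc.image _
        (P₁.unit_speed.nonexpansiveOn.continuousOn.mono (Icc_subset_Icc hs.1 ht.2))⟩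
  refine isPreconnected_of_forall_pair ?_
  rintro _ ⟨⟨s, hs, rfl⟩, hs₂⟩ _ ⟨⟨t, ht, rfl⟩, ht₂⟩
  rcases le_total s t with hst | hst
  · exact key s hs t ht hst hs₂ ht₂
  · obtain ⟨C, hC, h1, h2, h3⟩ := key t ht s hs hst ht₂ hs₂
    exact ⟨C, hC, h2, h1, h3⟩

end TangentGraphPath

end Environment

theorem lemma3 (W : Environment) (r₁₁ r₁₂ r₂₁ r₂₂ : Plane)
    (P₁ : W.TangentGraphPath r₁₁ r₁₂) (P₂ : W.TangentGraphPath r₂₁ r₂₂)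
    (h₁ : P₁.IsShortest) (h₂ : P₂.IsShortest)
    (hu : P₁.IsUniqueShortest ∨ P₂.IsUniqueShortest) :
    IsPreconnected (P₁.trace ∩ P₂.trace) := by
  rcases hu with hu | hu
  · exact hu.isPreconnected_inter h₂
  · rw [inter_comm]
    exact hu.isPreconnected_inter h₁
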